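/- Let $R$ be an arbitrary associative ring with unity (not necessarily commutative). Say that a (left or right) $R$-module $M$ is of type $FP_\infty$ if it has a projective resolution by finitely generated projective modules. A right $R$-module $I$ is called absolutely clean if $\operatorname{Ext}^1_R(M,I)=0$ for every right $R$-module $M$ of type $FP_\infty$; a left $R$-module $F$ is called level if $\operatorname{Tor}_1^R(M,F)=0$ for every right $R$-module $M$ of type $FP_\infty$. Let $C$ be a ($\mathbb{Z}$-indexed, possibly unbounded) chain complex of projective left $R$-modules. Then the following are equivalent: 1. the complex of abelian groups $I\otimes_R C$ is exact for every absolutely clean right $R$-module $I$; 2. the complex of abelian groups $\operatorname{Hom}_R(C,F)$ is exact for every level left $R$-module $F$. If, moreover, every level left $R$-module has finite projective dimension, then (1) and (2) are also equivalent to 3. $\operatorname{Hom}_R(C,P)$ is exact for every projective left $R$-module $P$. -/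

import Mathlib

open CategoryTheory

open scoped TensorProduct

universe u

/-! Throughout, `R` is an arbitrary (not necessarily commutative) ring with unity.  Left `R`-modules
are objects of `ModuleCat R`, and right `R`-modules are objects of `ModuleCat Rᵐᵒᵖ`
(the right action of `r` on `m` is `MulOpposite.op r • m`). -/

noncomputable section

namespace ACModules

variable (R : Type u) [Ring R]

section Tensor

variable (M : Type u) [AddCommGroup M] [Module Rᵐᵒᵖ M] (N : Type u) [AddCommGroup N] [Module R N]

/-- The relations `(m r) ⊗ n = m ⊗ (r n)` in `M ⊗_ℤ N`. -/
def tensorRel : AddSubgroup (M ⊗[ℤ] N) :=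
  AddSubgroup.closure {x | ∃ (m : M) (r : R) (n : N),
    x = (MulOpposite.op r • m) ⊗ₜ[ℤ] n - m ⊗ₜ[ℤ] (r • n)}

/-- The abelian group `M ⊗_R N`, for a right `R`-module `M` and a left `R`-module `N`. -/
abbrev Tensor : Type u := (M ⊗[ℤ] N) ⧸ tensorRel R M N

variable {M N}
variable {M' : Type u} [AddCommGroup M'] [Module Rᵐᵒᵖ M']
  {N' : Type u} [AddCommGroup N'] [Module R N']

/-- The elementary tensor `m ⊗ n` in `M ⊗_R N`. -/
def tmul (m : M) (n : N) : Tensor R M N := QuotientAddGroup.mk (m ⊗ₜ[ℤ] n)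

theorem tmul_add_left (m m' : M) (n : N) :
    tmul R (m + m') n = tmul R m n + tmul R m' n := by
  simp [tmul, TensorProduct.add_tmul]

variable {R}

/-- The homomorphism `f ⊗ g : M ⊗_R N → M' ⊗_R N'`, `m ⊗ n ↦ f m ⊗ g n`. -/
def tensorMap (f : M →ₗ[Rᵐᵒᵖ] M') (g : N →ₗ[R] N') : Tensor R M N →+ Tensor R M' N' :=
  QuotientAddGroup.map (tensorRel R M N) (tensorRel R M' N')
    (TensorProduct.map f.toAddMonoidHom.toIntLinearMap
      g.toAddMonoidHom.toIntLinearMap).toAddMonoidHom (by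
      refine (AddSubgroup.closure_le _).2 ?_
      rintro _ ⟨m, r, n, rfl⟩
      refine AddSubgroup.subset_closure ⟨f m, r, g n, ?_⟩
      simp)

theorem tensorMap_tmul (f : M →ₗ[Rᵐᵒᵖ] M') (g : N →ₗ[R] N') (m : M) (n : N) :
    tensorMap f g (tmul R m n) = tmul R (f m) (g n) := rfl

theorem tensor_hom_ext {A : Type*} [AddCommGroup A] {f g : Tensor R M N →+ A}
    (h : ∀ m n, f (tmul R m n) = g (tmul R m n)) : f = g := by
  refine DFunLike.ext _ _ fun x => ?_
  obtain ⟨y, rfl⟩ := QuotientAddGroup.mk_surjective x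
  induction y using TensorProduct.induction_on with
  | zero => simp
  | tmul m n => exact h m n
  | add a b ha hb => rw [QuotientAddGroup.mk_add, map_add, map_add, ha, hb]

end Tensor

/-- The functor `- ⊗_R N` from right `R`-modules to abelian groups. -/
def tensorRight (N : ModuleCat.{u} R) : ModuleCat.{u} Rᵐᵒᵖ ⥤ AddCommGrpCat.{u} where
  obj M := AddCommGrpCat.of (Tensor R M N)
  map f := AddCommGrpCat.ofHom (tensorMap (R := R) f.hom LinearMap.id)
  map_id _ := AddCommGrpCat.hom_ext (tensor_hom_ext fun _ _ => rfl)
  map_comp _ _ := AddCommGrpCat.hom_ext (tensor_hom_ext fun _ _ => rfl)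

instance (N : ModuleCat.{u} R) : (tensorRight R N).Additive where
  map_add {_ _ f g} := AddCommGrpCat.hom_ext (tensor_hom_ext fun m n =>
    tmul_add_left R (f.hom m) (g.hom m) n)

/-- `Tor_n^R(M, N)`, the left derived functors of `- ⊗_R N` evaluated at the right module `M`. -/
def tor (n : ℕ) (M : ModuleCat.{u} Rᵐᵒᵖ) (N : ModuleCat.{u} R) : AddCommGrpCat.{u} :=
  ((tensorRight R N).leftDerived n).obj M

variable {R}

/-- `M` is of type `FP_∞`: it has a projective resolution by finitely generated projectives. -/
def IsFPInfty (M : ModuleCat.{u} R) : Prop :=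
  ∃ P : ProjectiveResolution M, ∀ n, Module.Finite R (P.complex.X n)

/-- `N` is absolutely clean: `Ext^1_R(M, N) = 0` for all `M` of type `FP_∞`. -/
def IsAbsolutelyClean (N : ModuleCat.{u} R) : Prop :=
  ∀ M : ModuleCat.{u} R, IsFPInfty M → Subsingleton (Abelian.Ext.{u} M N 1)

/-- The left module `N` is level: `Tor_1^R(M, N) = 0` for all right modules `M` of type `FP_∞`. -/
def IsLevel (N : ModuleCat.{u} R) : Prop :=
  ∀ M : ModuleCat.{u} Rᵐᵒᵖ, IsFPInfty M → Subsingleton (tor R 1 M N)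

/-- The complex of abelian groups `I ⊗_R C` is exact (in every degree). -/
def TensorExact (I : ModuleCat.{u} Rᵐᵒᵖ) (C : ChainComplex (ModuleCat.{u} R) ℤ) : Prop :=
  ∀ n : ℤ, Function.Exact
    (tensorMap (LinearMap.id : I →ₗ[Rᵐᵒᵖ] I) (C.d (n + 1) n).hom)
    (tensorMap (LinearMap.id : I →ₗ[Rᵐᵒᵖ] I) (C.d n (n - 1)).hom)

/-- The complex of abelian groups `Hom_R(C, F)`, with differentials given by precomposition with
those of `C`, is exact (in every degree). -/
def HomExact (C : ChainComplex (ModuleCat.{u} R) ℤ) (F : ModuleCat.{u} R) : Prop :=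
  ∀ n : ℤ, Function.Exact
    (fun g : C.X (n - 1) ⟶ F => C.d n (n - 1) ≫ g)
    (fun g : C.X n ⟶ F => C.d (n + 1) n ≫ g)

/-- `I ⊗_R C` is exact for all absolutely clean right `R`-modules `I`. -/
def IsACAcyclic (C : ChainComplex (ModuleCat.{u} R) ℤ) : Prop :=
  ∀ I : ModuleCat.{u} Rᵐᵒᵖ, IsAbsolutelyClean I → TensorExact I C

/-- `Hom_R(C, F)` is exact for all level left `R`-modules `F`. -/
def IsFirmlyAcyclic (C : ChainComplex (ModuleCat.{u} R) ℤ) : Prop :=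
  ∀ F : ModuleCat.{u} R, IsLevel F → HomExact C F

end ACModules

end

/-!
Write `M^+` for the character module `Hom_ℤ(M, ℚ/ℤ)`. Since `ℚ/ℤ` is an injective cogenerator,
hom-tensor adjunction shows that `F` is level if and only if `F^+` is absolutely clean
(`isLevel_iff_char`), and that `I ⊗_R C` is exact if and only if `Hom_R(C, I^+)` is
(`tensorExact_iff_homExact_char`). If `I` is absolutely clean then `I^+` is level
(`IsAbsolutelyClean.isLevel_char`), because `P ⊗_R I^+ ≅ Hom(P, I)^+` for finitely generated
projective `P`. Hence firm acyclicity implies AC-acyclicity.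

Conversely, let `C` be AC-acyclic and `F` level. Then `F^+` is absolutely clean, so
`Hom_R(C, F^{++})` is exact. The embedding `F → F^{++}` is pure (`Char.isPure_eval`) and its cokernel
is again level (`IsLevel.char_char_quotient`), so iterating gives a pure exact complex
`0 → F → D 0 → D 1 → ⋯` with all `Hom_R(C, D k)` exact. A cocycle `C n → F` therefore extends, one
degree at a time, to a chain map from the part of `C` below degree `n` to the complex of the `D k`.
Such a chain map is null-homotopic, and a null-homotopy extends the cocycle to `C (n - 1)`
(`homExact_of_pure_coresolution`).

The key point is thus a case of a theorem of Neeman: chain maps from complexes of projective modules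
to pure exact complexes are null-homotopic (`IsPureExact.exists_homotopy`). A complex of projectives
is a retract of a complex of free modules. In the latter every basis vector lies in a subcomplex that
is free on finitely many basis vectors in each degree, so Zorn's lemma reduces the claim to complexes
of finite free modules. There, purity solves the homotopy equation directly.

For the last equivalence, projective modules are level (`isLevel_of_projective`), and exactness of
`Hom_R(C, -)` passes from projective modules to modules of finite projective dimension by induction
along short exact sequences (`HomExact.of_shortExact`).
-/

namespace ACModules

/-! ### Chain maps from complexes of projective modules to pure exact complexes -/

section PureCoresolutions

variable {R : Type u} [Ring R]

/-- A linear map `i : F → D` is pure if every finite system of linear equations with right-hand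
sides in `F` that is solvable in `D` is solvable in `F`. A system is a finite family `b` of vectors
of a finite free module, and its solutions are the linear maps with prescribed values on `b`. -/
def IsPure {F D : Type u} [AddCommGroup F] [Module R F] [AddCommGroup D] [Module R D]
    (i : F →ₗ[R] D) : Prop :=
  ∀ (V W : Type u) [Finite V] [Finite W] (b : W → V →₀ R) (f : (V →₀ R) →ₗ[R] D),
    (∀ w, f (b w) ∈ LinearMap.range i) →
      ∃ t : (V →₀ R) →ₗ[R] F, ∀ w, i (t (b w)) = f (b w)

variable {X : ℕ → Type u} [∀ k, AddCommGroup (X k)] [∀ k, Module R (X k)]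

/-- The sequence `0 → X 0 → X 1 → X 2 → ⋯` is a pure exact complex. The last field, applied to a
basis as the family `b`, contains exactness at `X (k + 1)`; in general it says that the kernel of
`δ (k + 1)` is pure in `X (k + 1)`. -/
structure IsPureExact (δ : ∀ k, X k →ₗ[R] X (k + 1)) : Prop where
  injective : Function.Injective (δ 0)
  comp_eq_zero : ∀ k x, δ (k + 1) (δ k x) = 0
  solve : ∀ (k : ℕ) (V W : Type u) [Finite V] [Finite W] (b : W → V →₀ R)
    (f : (V →₀ R) →ₗ[R] X (k + 1)), (∀ w, δ (k + 1) (f (b w)) = 0) →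
      ∃ t : (V →₀ R) →ₗ[R] X k, ∀ w, δ k (t (b w)) = f (b w)

variable {δ : ∀ k, X k →ₗ[R] X (k + 1)}

theorem IsPureExact.lift (hδ : IsPureExact δ) (k : ℕ) {V : Type u} [Finite V]
    (f : (V →₀ R) →ₗ[R] X (k + 1)) (hf : ∀ v, δ (k + 1) (f v) = 0) :
    ∃ t : (V →₀ R) →ₗ[R] X k, ∀ v, δ k (t v) = f v := by
  obtain ⟨t, ht⟩ := hδ.solve k V V (fun v => Finsupp.single v 1) f (fun _ => hf _)
  refine ⟨t, fun v => ?_⟩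
  have : δ k ∘ₗ t = f := Finsupp.lhom_ext' fun v => LinearMap.ext_ring (ht v)
  exact LinearMap.congr_fun this v

/-- A linear map into the cocycles of a pure exact complex which kills a finite family of vectors
lifts to a map into the previous term which kills the same family. -/
theorem IsPureExact.lift_of_vanish (hδ : IsPureExact δ) (k : ℕ) {V W : Type u} [Finite V] [Finite W]
    (b : W → V →₀ R) (f : (V →₀ R) →ₗ[R] X (k + 1)) (hf : ∀ v, δ (k + 1) (f v) = 0)
    (hb : ∀ w, f (b w) = 0) :
    ∃ t : (V →₀ R) →ₗ[R] X k, (∀ v, δ k (t v) = f v) ∧ ∀ w, t (b w) = 0 := by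
  obtain ⟨t, ht⟩ := hδ.lift k f hf
  have htb : ∀ w, δ k (t (b w)) = 0 := fun w => (ht _).trans (hb w)
  cases k with
  | zero => exact ⟨t, ht, fun w => hδ.injective (by rw [htb, map_zero])⟩
  | succ k =>
    obtain ⟨t', ht'⟩ := hδ.solve k V W b t htb
    exact ⟨t - δ k ∘ₗ t', fun v => by simp [ht, hδ.comp_eq_zero], fun w => by simp [ht']⟩

/-- A chain map from a complex of finite free modules to a pure exact complex is null-homotopic.
The homotopy is `t + t'`, where `t` solves the homotopy equation on coboundaries and `t'` corrects
the error. Neither choice depends on the other degrees. -/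
theorem IsPureExact.exists_homotopy_of_finite (hδ : IsPureExact δ) {V : ℕ → Type u}
    [∀ k, Finite (V k)] (d : ∀ k, (V k →₀ R) →ₗ[R] (V (k + 1) →₀ R))
    (hd : ∀ k x, d (k + 1) (d k x) = 0) (f : ∀ k, (V k →₀ R) →ₗ[R] X (k + 1))
    (hf : ∀ k x, δ (k + 1) (f k x) = f (k + 1) (d k x)) :
    ∃ s : ∀ k, (V k →₀ R) →ₗ[R] X k, ∀ k x, f k x = δ k (s k x) + s (k + 1) (d k x) := by
  have h1 : ∀ k, ∃ t : (V (k + 1) →₀ R) →ₗ[R] X (k + 1),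
      ∀ x, δ (k + 1) (t (d k x)) = f (k + 1) (d k x) := by
    intro k
    obtain ⟨t, ht⟩ := hδ.solve (k + 1) (V (k + 1)) (V k) (fun v => d k (Finsupp.single v 1))
      (f (k + 1)) (fun v => by rw [hf, hd, map_zero])
    refine ⟨t, fun x => ?_⟩
    have : δ (k + 1) ∘ₗ t ∘ₗ d k = f (k + 1) ∘ₗ d k :=
      Finsupp.lhom_ext' fun v => LinearMap.ext_ring (ht v)
    exact LinearMap.congr_fun this x
  choose t ht using h1
  -- In degree `0` there are no coboundaries, so zero is a valid first choice.
  let T : ∀ k, (V k →₀ R) →ₗ[R] X k := fun k => Nat.casesOn k 0 t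
  have hT : ∀ k x, δ (k + 1) (T (k + 1) (d k x)) = f (k + 1) (d k x) := ht
  let m : ∀ k, (V k →₀ R) →ₗ[R] X (k + 1) := fun k => f k - δ k ∘ₗ T k - T (k + 1) ∘ₗ d k
  have hm : ∀ k x, δ (k + 1) (m k x) = 0 := fun k x => by
    simp [m, hf, hT, hδ.comp_eq_zero]
  have hmd : ∀ k x, m (k + 1) (d k x) = 0 := fun k x => by simp [m, hd, hT]
  have h2 : ∀ k, ∃ t' : (V k →₀ R) →ₗ[R] X k, (∀ x, δ k (t' x) = m k x) ∧
      ∀ j (h : j + 1 = k) x, t' (h ▸ d j x) = 0 := by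
    intro k
    cases k with
    | zero =>
      obtain ⟨t', ht'⟩ := hδ.lift 0 (m 0) (hm 0)
      exact ⟨t', ht', fun j h => by omega⟩
    | succ k =>
      obtain ⟨t', ht', h0⟩ := hδ.lift_of_vanish (k + 1) (fun v : V k => d k (Finsupp.single v 1))
        (m (k + 1)) (hm _) (fun v => hmd _ _)
      refine ⟨t', ht', fun j h x => ?_⟩
      obtain rfl : j = k := by omega
      have : t' ∘ₗ d j = 0 := Finsupp.lhom_ext' fun v => LinearMap.ext_ring (h0 v)
      exact LinearMap.congr_fun this x
  choose t' ht' h0 using h2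
  refine ⟨fun k => T k + t' k, fun k x => ?_⟩
  have := h0 (k + 1) k rfl x
  simp only at this
  simp only [LinearMap.add_apply, map_add, ht', this, m, LinearMap.sub_apply, LinearMap.comp_apply]
  abel

/-- The smallest family of subsets containing `b` in degree `n` that spans a subcomplex: in each
degree it consists of the basis vectors needed to express the differentials one degree below. -/
def closureOf {S : ℕ → Type u} (d : ∀ k, (S k →₀ R) →ₗ[R] (S (k + 1) →₀ R)) (n : ℕ) (b : S n) :
    ∀ k, Set (S k)
  | 0 => {c | ∃ h : n = 0, h ▸ b = c}
  | k + 1 => {c | ∃ h : n = k + 1, h ▸ b = c} ∪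
      ⋃ a ∈ closureOf d n b k, ↑(d k (Finsupp.single a 1)).support

section closureOf

variable {S : ℕ → Type u} (d : ∀ k, (S k →₀ R) →ₗ[R] (S (k + 1) →₀ R)) (n : ℕ) (b : S n)

theorem mem_closureOf : b ∈ closureOf d n b n := by
  cases n with
  | zero => exact ⟨rfl, rfl⟩
  | succ n => exact Or.inl ⟨rfl, rfl⟩

theorem finite_closureOf (k : ℕ) : (closureOf d n b k).Finite := by
  have h (k : ℕ) : {c : S k | ∃ h : n = k, h ▸ b = c}.Finite :=
    Set.Subsingleton.finite (by rintro _ ⟨h, rfl⟩ _ ⟨_, rfl⟩; rfl)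
  induction k with
  | zero => exact h 0
  | succ k ih => exact (h (k + 1)).union (ih.biUnion fun a _ => Finset.finite_toSet _)

theorem support_subset_closureOf (k : ℕ) (a : S k) (ha : a ∈ closureOf d n b k) :
    ↑(d k (Finsupp.single a 1)).support ⊆ closureOf d n b (k + 1) :=
  fun _ hc => Or.inr (Set.mem_biUnion ha hc)

end closureOf

theorem map_mem_supported {S S' : Type u} (g : (S →₀ R) →ₗ[R] (S' →₀ R)) {T : Set S} {T' : Set S'}
    (h : ∀ a ∈ T, ↑(g (Finsupp.single a 1)).support ⊆ T') {x : S →₀ R}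
    (hx : x ∈ Finsupp.supported R R T) : g x ∈ Finsupp.supported R R T' := by
  rw [Finsupp.supported_eq_span_single] at hx
  induction hx using Submodule.span_induction with
  | mem x hx =>
    obtain ⟨a, ha, rfl⟩ := hx
    exact h a ha
  | zero => simp
  | add x y _ _ hx hy => rw [map_add]; exact add_mem hx hy
  | smul r x _ hx => rw [map_smul]; exact Submodule.smul_mem _ _ hx

theorem eq_of_eqOn_supported {S M : Type u} [AddCommGroup M] [Module R M] {g g' : (S →₀ R) →ₗ[R] M}
    {T : Set S} (h : ∀ a ∈ T, g (Finsupp.single a 1) = g' (Finsupp.single a 1)) {x : S →₀ R}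
    (hx : x ∈ Finsupp.supported R R T) : g x = g' x := by
  rw [Finsupp.supported_eq_span_single] at hx
  refine LinearMap.eqOn_span (f := g) (g := g') ?_ hx
  rintro _ ⟨a, ha, rfl⟩
  exact h a ha

/-- Let `T` and `U` be sets of basis vectors spanning subcomplexes, with `U` finite in each degree,
and let `f` be a chain map vanishing on `T`. Then some homotopy vanishes on `T` and contracts `f` on
`T ∪ U`. It comes from the quotient of the span of `T ∪ U` by the span of `T`, which is free on the
finite sets `U \ T`. -/
theorem IsPureExact.exists_homotopy_union (hδ : IsPureExact δ) {S : ℕ → Type u}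
    (d : ∀ k, (S k →₀ R) →ₗ[R] (S (k + 1) →₀ R))
    (hd : ∀ k x, d (k + 1) (d k x) = 0) (f : ∀ k, (S k →₀ R) →ₗ[R] X (k + 1))
    (hf : ∀ k x, δ (k + 1) (f k x) = f (k + 1) (d k x))
    (T U : ∀ k, Set (S k))
    (hT : ∀ k, ∀ a ∈ T k, ↑(d k (Finsupp.single a 1)).support ⊆ T (k + 1))
    (hU : ∀ k, ∀ a ∈ U k, ↑(d k (Finsupp.single a 1)).support ⊆ U (k + 1))
    (hfin : ∀ k, (U k).Finite) (hfT : ∀ k, ∀ a ∈ T k, f k (Finsupp.single a 1) = 0) :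
    ∃ s : ∀ k, (S k →₀ R) →ₗ[R] X k, (∀ k, ∀ a ∈ T k, s k (Finsupp.single a 1) = 0) ∧
      ∀ k, ∀ a ∈ T k ∪ U k, f k (Finsupp.single a 1) =
        δ k (s k (Finsupp.single a 1)) + s (k + 1) (d k (Finsupp.single a 1)) := by
  let V : ℕ → Type u := fun k => ↑(U k \ T k)
  have : ∀ k, Finite (V k) := fun k => ((hfin k).subset Set.sdiff_subset).to_subtype
  let p : ∀ k, (S k →₀ R) →ₗ[R] (V k →₀ R) := fun k => Finsupp.lsubtypeDomain (U k \ T k)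
  let i : ∀ k, (V k →₀ R) →ₗ[R] (S k →₀ R) := fun k => Finsupp.lmapDomain R R Subtype.val
  have hpT : ∀ k x, x ∈ Finsupp.supported R R (T k) → p k x = 0 := by
    intro k x hx
    refine Finsupp.ext fun v => ?_
    by_contra h
    exact v.2.2 (hx (Finsupp.mem_support_iff.2 h))
  have hdT : ∀ k x, x ∈ Finsupp.supported R R (T k) → d k x ∈ Finsupp.supported R R (T (k + 1)) :=
    fun k x hx => map_mem_supported (d k) (hT k) hx
  have hdU : ∀ k x, x ∈ Finsupp.supported R R (U k) → d k x ∈ Finsupp.supported R R (U (k + 1)) :=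
    fun k x hx => map_mem_supported (d k) (hU k) hx
  have hfT' : ∀ k x, x ∈ Finsupp.supported R R (T k) → f k x = 0 := fun k x hx =>
    eq_of_eqOn_supported (g' := 0) (hfT k) hx
  have hi : ∀ k v, i k (Finsupp.single v 1) = Finsupp.single v.1 1 := fun k v => by simp [i]
  have hiU : ∀ k x, i k x ∈ Finsupp.supported R R (U k) := by
    intro k x
    have hx : x ∈ Finsupp.supported R R (Set.univ : Set (V k)) := by simp
    refine map_mem_supported (i k) (fun a _ => ?_) hx
    rw [hi]
    exact (Finset.coe_subset.2 Finsupp.support_single_subset).trans (by simpa using a.2.1)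
  -- Modulo the span of `T`, restricting coefficients to `U \ T` is the identity on the span of `U`.
  have hip : ∀ k x, x ∈ Finsupp.supported R R (U k) →
      x - i k (p k x) ∈ Finsupp.supported R R (T k) := by
    intro k x hx c hc
    by_contra hcT
    apply Finsupp.mem_support_iff.1 hc
    by_cases hcU : c ∈ U k
    · have : i k (p k x) c = x c := by
        have := Finsupp.mapDomain_apply (f := (Subtype.val : V k → S k)) Subtype.val_injective
          (p k x) ⟨c, hcU, hcT⟩
        exact this
      simp [this]
    · have h1 : x c = 0 := by
        by_contra h
        exact hcU (hx (Finsupp.mem_support_iff.2 h))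
      have h2 : i k (p k x) c = 0 := by
        by_contra h
        exact hcU (hiU k _ (Finsupp.mem_support_iff.2 h))
      simp [h1, h2]
  let e : ∀ k, (V k →₀ R) →ₗ[R] (V (k + 1) →₀ R) := fun k => p (k + 1) ∘ₗ d k ∘ₗ i k
  have hpd : ∀ k x, x ∈ Finsupp.supported R R (U k) → e k (p k x) = p (k + 1) (d k x) := by
    intro k x hx
    have := hpT _ _ (hdT _ _ (hip k x hx))
    rw [map_sub, map_sub, sub_eq_zero] at this
    exact this.symm
  have hfi : ∀ k x, x ∈ Finsupp.supported R R (U k) → f k (i k (p k x)) = f k x := by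
    intro k x hx
    have := hfT' _ _ (hip k x hx)
    rw [map_sub, sub_eq_zero] at this
    exact this.symm
  obtain ⟨s, hs⟩ := hδ.exists_homotopy_of_finite e
    (fun k x => by
      change e (k + 1) (p (k + 1) (d k (i k x))) = 0
      rw [hpd _ _ (hdU _ _ (hiU k x)), hd, map_zero])
    (fun k => f k ∘ₗ i k)
    (fun k x => by
      change δ (k + 1) (f k (i k x)) = f (k + 1) (i (k + 1) (p (k + 1) (d k (i k x))))
      rw [hfi _ _ (hdU _ _ (hiU k x)), hf])
  have hsingle : ∀ k (A : Set (S k)), ∀ a ∈ A,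
      Finsupp.single a (1 : R) ∈ Finsupp.supported R R A := fun k A a ha =>
    Finsupp.single_mem_supported R 1 ha
  refine ⟨fun k => s k ∘ₗ p k, fun k a ha => ?_, fun k a ha => ?_⟩
  · simp only [LinearMap.comp_apply, hpT k _ (hsingle k _ a ha), map_zero]
  · simp only [LinearMap.comp_apply]
    rcases ha with ha | ha
    · rw [hfT k a ha, hpT k _ (hsingle k _ a ha), hpT _ _ (hdT k _ (hsingle k _ a ha))]
      simp
    · rw [← hpd k _ (hsingle k _ a ha), ← hs]
      exact (hfi k _ (hsingle k _ a ha)).symm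

/-- A null-homotopy of `f` on the subcomplex spanned by the basis vectors in `carrier`. -/
structure PartialHomotopy {S : ℕ → Type u} (δ : ∀ k, X k →ₗ[R] X (k + 1))
    (d : ∀ k, (S k →₀ R) →ₗ[R] (S (k + 1) →₀ R))
    (f : ∀ k, (S k →₀ R) →ₗ[R] X (k + 1)) where
  carrier : ∀ k, Set (S k)
  closed : ∀ k, ∀ a ∈ carrier k, ↑(d k (Finsupp.single a 1)).support ⊆ carrier (k + 1)
  hom : ∀ k, (S k →₀ R) →ₗ[R] X k
  eq : ∀ k, ∀ a ∈ carrier k, f k (Finsupp.single a 1) =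
    δ k (hom k (Finsupp.single a 1)) + hom (k + 1) (d k (Finsupp.single a 1))

/-- Extension of partial homotopies. It is only a preorder, because the values outside the
carrier are irrelevant. -/
instance {S : ℕ → Type u} (δ : ∀ k, X k →ₗ[R] X (k + 1))
    (d : ∀ k, (S k →₀ R) →ₗ[R] (S (k + 1) →₀ R))
    (f : ∀ k, (S k →₀ R) →ₗ[R] X (k + 1)) : Preorder (PartialHomotopy δ d f) where
  le A B := ∀ k, ∀ a ∈ A.carrier k,
    a ∈ B.carrier k ∧ A.hom k (Finsupp.single a 1) = B.hom k (Finsupp.single a 1)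
  le_refl _ _ _ ha := ⟨ha, rfl⟩
  le_trans _ _ _ hAB hBC k a ha :=
    ⟨(hBC k a (hAB k a ha).1).1, (hAB k a ha).2.trans (hBC k a (hAB k a ha).1).2⟩

theorem PartialHomotopy.bddAbove_of_isChain {S : ℕ → Type u}
    {d : ∀ k, (S k →₀ R) →ₗ[R] (S (k + 1) →₀ R)} {f : ∀ k, (S k →₀ R) →ₗ[R] X (k + 1)}
    (c : Set (PartialHomotopy δ d f)) (hc : IsChain (· ≤ ·) c) : BddAbove c := by
  classical
  let h : ∀ k, (S k →₀ R) →ₗ[R] X k := fun k => Finsupp.linearCombination R fun a =>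
    if ha : ∃ A ∈ c, a ∈ A.carrier k then ha.choose.hom k (Finsupp.single a 1) else 0
  have hh : ∀ A ∈ c, ∀ k, ∀ a ∈ A.carrier k,
      h k (Finsupp.single a 1) = A.hom k (Finsupp.single a 1) := by
    intro A hA k a ha
    have hex : ∃ A ∈ c, a ∈ A.carrier k := ⟨A, hA, ha⟩
    have : h k (Finsupp.single a 1) = hex.choose.hom k (Finsupp.single a 1) := by
      simp only [h, Finsupp.linearCombination_single, one_smul, dif_pos hex]
    rw [this]
    obtain ⟨h1, h2⟩ := hex.choose_spec
    rcases hc.total h1 hA with hle | hle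
    · exact (hle k a h2).2
    · exact (hle k a ha).2.symm
  refine ⟨⟨fun k => {a | ∃ A ∈ c, a ∈ A.carrier k}, ?_, h, ?_⟩, ?_⟩
  · rintro k a ⟨A, hA, ha⟩ x hx
    exact ⟨A, hA, A.closed k a ha hx⟩
  · rintro k a ⟨A, hA, ha⟩
    rw [A.eq k a ha, hh A hA k a ha]
    congr 1
    exact (eq_of_eqOn_supported (hh A hA (k + 1)) (A.closed k a ha)).symm
  · intro A hA k a ha
    exact ⟨⟨A, hA, ha⟩, (hh A hA k a ha).symm⟩

/-- A chain map from a complex of free modules to a pure exact complex is null-homotopic. -/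
theorem IsPureExact.exists_homotopy_of_free (hδ : IsPureExact δ) {S : ℕ → Type u}
    (d : ∀ k, (S k →₀ R) →ₗ[R] (S (k + 1) →₀ R))
    (hd : ∀ k x, d (k + 1) (d k x) = 0) (f : ∀ k, (S k →₀ R) →ₗ[R] X (k + 1))
    (hf : ∀ k x, δ (k + 1) (f k x) = f (k + 1) (d k x)) :
    ∃ s : ∀ k, (S k →₀ R) →ₗ[R] X k, ∀ k x, f k x = δ k (s k x) + s (k + 1) (d k x) := by
  obtain ⟨A, hA⟩ := zorn_le (α := PartialHomotopy δ d f)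
    PartialHomotopy.bddAbove_of_isChain
  -- A maximal partial homotopy is total: otherwise contract the error on the closure of `b`.
  have key : ∀ n (b : S n), b ∈ A.carrier n := by
    intro n b
    let g : ∀ k, (S k →₀ R) →ₗ[R] X (k + 1) := fun k =>
      f k - δ k ∘ₗ A.hom k - A.hom (k + 1) ∘ₗ d k
    obtain ⟨s, hs0, hs⟩ := hδ.exists_homotopy_union d hd g
      (fun k x => by simp [g, hf, hd, hδ.comp_eq_zero]) A.carrier (closureOf d n b)
      A.closed (support_subset_closureOf d n b) (finite_closureOf d n b)
      (fun k a ha => by simp [g, A.eq k a ha])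
    let B : PartialHomotopy δ d f :=
      { carrier := fun k => A.carrier k ∪ closureOf d n b k
        closed := by
          rintro k a (ha | ha)
          · exact (A.closed k a ha).trans Set.subset_union_left
          · exact (support_subset_closureOf d n b k a ha).trans Set.subset_union_right
        hom := fun k => A.hom k + s k
        eq := by
          intro k a ha
          have := hs k a ha
          simp only [g, LinearMap.sub_apply, LinearMap.comp_apply, sub_eq_iff_eq_add] at this
          rw [this]
          simp only [LinearMap.add_apply, map_add]
          abel }
    have hAB : A ≤ B := fun k a ha => ⟨Or.inl ha, by simp [B, hs0 k a ha]⟩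
    exact (hA hAB n b (Or.inr (mem_closureOf d n b))).1
  refine ⟨A.hom, fun k x => ?_⟩
  have : f k = δ k ∘ₗ A.hom k + A.hom (k + 1) ∘ₗ d k :=
    Finsupp.lhom_ext' fun v => LinearMap.ext_ring (A.eq k v (key k v))
  exact LinearMap.congr_fun this x

/-- A chain map from a complex of projective modules to a pure exact complex is null-homotopic.
If `p : L → E` is a degreewise split epimorphism from free modules with section `i`, then
`i ∘ d ∘ p` is a differential on `L`, and it makes `E` a retract of a complex of free modules. -/
theorem IsPureExact.exists_homotopy (hδ : IsPureExact δ) {E : ℕ → Type u}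
    [∀ k, AddCommGroup (E k)] [∀ k, Module R (E k)] (hE : ∀ k, Module.Projective R (E k))
    (d : ∀ k, E k →ₗ[R] E (k + 1))
    (hd : ∀ k x, d (k + 1) (d k x) = 0) (f : ∀ k, E k →ₗ[R] X (k + 1))
    (hf : ∀ k x, δ (k + 1) (f k x) = f (k + 1) (d k x)) :
    ∃ s : ∀ k, E k →ₗ[R] X k, ∀ k x, f k x = δ k (s k x) + s (k + 1) (d k x) := by
  choose i hi using fun k => Module.projective_def'.1 (hE k)
  let p : ∀ k, (E k →₀ R) →ₗ[R] E k := fun k => Finsupp.linearCombination R id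
  have hp : ∀ k x, p k (i k x) = x := fun k x => LinearMap.congr_fun (hi k) x
  obtain ⟨s, hs⟩ := hδ.exists_homotopy_of_free (fun k => i (k + 1) ∘ₗ d k ∘ₗ p k)
    (fun k x => by simp [hp, hd]) (fun k => f k ∘ₗ p k) (fun k x => by simp [hp, hf])
  refine ⟨fun k => s k ∘ₗ i k, fun k x => ?_⟩
  simpa [hp] using hs k (i k x)

end PureCoresolutions

/-! ### Character modules -/

section Characters

/-- The group `Hom_ℤ(A, ℚ/ℤ)` of characters of an abelian group. It is a type synonym, so that it
can be given the module structures of the opposite side. -/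
def Char (A : Type u) [AddCommGroup A] : Type u := CharacterModule A

section

variable {A : Type u} [AddCommGroup A]

instance : AddCommGroup (Char A) := inferInstanceAs (AddCommGroup (A →+ AddCircle (1 : ℚ)))

instance : FunLike (Char A) A (AddCircle (1 : ℚ)) :=
  inferInstanceAs (FunLike (A →+ AddCircle (1 : ℚ)) _ _)

instance : AddMonoidHomClass (Char A) A (AddCircle (1 : ℚ)) :=
  inferInstanceAs (AddMonoidHomClass (A →+ AddCircle (1 : ℚ)) _ _)

/-- A homomorphism to `ℚ/ℤ`, regarded as a character. -/
def Char.mk (f : A →+ AddCircle (1 : ℚ)) : Char A := f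

@[simp] theorem Char.add_apply (χ ψ : Char A) (a : A) : (χ + ψ) a = χ a + ψ a := rfl

@[simp] theorem Char.sub_apply (χ ψ : Char A) (a : A) : (χ - ψ) a = χ a - ψ a := rfl

@[ext] theorem Char.ext {χ ψ : Char A} (h : ∀ a, χ a = ψ a) : χ = ψ := DFunLike.ext _ _ h

theorem Char.sum_apply {ι : Type*} (s : Finset ι) (χ : ι → Char A) (a : A) :
    (∑ i ∈ s, χ i) a = ∑ i ∈ s, χ i a :=
  AddMonoidHom.finsetSum_apply (M := A) (N := AddCircle (1 : ℚ)) χ s a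

/-- The group of characters separates points modulo a subgroup. -/
theorem Char.exists_ne_zero (H : AddSubgroup A) {a : A} (ha : a ∉ H) :
    ∃ χ : Char A, (∀ x ∈ H, χ x = 0) ∧ χ a ≠ 0 := by
  obtain ⟨c, hc⟩ := CharacterModule.exists_character_apply_ne_zero_of_ne_zero
    (a := (QuotientAddGroup.mk a : A ⧸ H)) (by rwa [Ne, QuotientAddGroup.eq_zero_iff])
  refine ⟨Char.mk (AddMonoidHom.comp c (QuotientAddGroup.mk' H)), fun x hx => ?_, hc⟩
  change c (QuotientAddGroup.mk x) = 0
  rw [(QuotientAddGroup.eq_zero_iff x).2 hx]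
  exact map_zero c

/-- Exactness can be tested on characters, since `ℚ/ℤ` is an injective cogenerator. -/
theorem exact_iff_char {A B C : Type u} [AddCommGroup A] [AddCommGroup B] [AddCommGroup C]
    (f : A →+ B) (g : B →+ C) (hgf : ∀ a, g (f a) = 0) :
    Function.Exact f g ↔
      ∀ χ : Char B, (∀ a, χ (f a) = 0) → ∃ ψ : Char C, ∀ b, ψ (g b) = χ b := by
  constructor
  · intro h χ hχ
    let χ' : B ⧸ g.ker →+ AddCircle (1 : ℚ) := QuotientAddGroup.lift g.ker χ fun b hb => by
      obtain ⟨a, rfl⟩ := (h b).1 hb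
      exact hχ a
    obtain ⟨ψ, hψ⟩ := CharacterModule.dual_surjective_of_injective
      (QuotientAddGroup.kerLift g).toIntLinearMap (QuotientAddGroup.kerLift_injective g) χ'
    exact ⟨ψ, fun b => DFunLike.congr_fun hψ (QuotientAddGroup.mk b)⟩
  · intro h b
    refine ⟨fun hb => ?_, fun ⟨a, ha⟩ => ha ▸ hgf a⟩
    by_contra hb'
    obtain ⟨χ, h1, h2⟩ := Char.exists_ne_zero f.range (a := b) hb'
    obtain ⟨ψ, hψ⟩ := h χ fun a => h1 _ ⟨a, rfl⟩
    exact h2 (by rw [← hψ, hb, map_zero])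

end

variable {R : Type u} [Ring R]

/-- The characters of a right module form a left module, with `(r χ)(m) = χ(m r)`. -/
instance {M : Type u} [AddCommGroup M] [Module Rᵐᵒᵖ M] : Module R (Char M) where
  smul r χ := Char.mk (AddMonoidHom.comp χ (DistribSMul.toAddMonoidHom M (MulOpposite.op r)))
  one_smul χ := Char.ext fun m => congrArg χ (one_smul Rᵐᵒᵖ m)
  mul_smul r s χ := Char.ext fun m => congrArg χ (mul_smul (MulOpposite.op s) (MulOpposite.op r) m)
  smul_zero _ := rfl
  smul_add _ _ _ := rfl
  add_smul r s χ := Char.ext fun m =>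
    (congrArg χ (add_smul (MulOpposite.op r) (MulOpposite.op s) m)).trans (map_add χ _ _)
  zero_smul χ := Char.ext fun m => (congrArg χ (zero_smul Rᵐᵒᵖ m)).trans (map_zero χ)

/-- The characters of a left module form a right module, with `(χ r)(m) = χ(r m)`. -/
instance {M : Type u} [AddCommGroup M] [Module R M] : Module Rᵐᵒᵖ (Char M) where
  smul r χ := Char.mk (AddMonoidHom.comp χ (DistribSMul.toAddMonoidHom M r.unop))
  one_smul χ := Char.ext fun m => congrArg χ (one_smul R m)
  mul_smul r s χ := Char.ext fun m => congrArg χ (mul_smul s.unop r.unop m)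
  smul_zero _ := rfl
  smul_add _ _ _ := rfl
  add_smul r s χ := Char.ext fun m =>
    (congrArg χ (add_smul r.unop s.unop m)).trans (map_add χ _ _)
  zero_smul χ := Char.ext fun m => (congrArg χ (zero_smul R m)).trans (map_zero χ)

@[simp] theorem Char.smul_apply {M : Type u} [AddCommGroup M] [Module Rᵐᵒᵖ M] (r : R) (χ : Char M)
    (m : M) : (r • χ) m = χ (MulOpposite.op r • m) := rfl

@[simp] theorem Char.op_smul_apply {M : Type u} [AddCommGroup M] [Module R M] (r : Rᵐᵒᵖ)
    (χ : Char M) (m : M) : (r • χ) m = χ (r.unop • m) := rfl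

/-- The right module homomorphism `N^+ → M^+` given by precomposition with `f : M → N`. -/
def Char.map {M N : Type u} [AddCommGroup M] [Module R M] [AddCommGroup N] [Module R N]
    (f : M →ₗ[R] N) : Char N →ₗ[Rᵐᵒᵖ] Char M where
  toFun χ := Char.mk (AddMonoidHom.comp χ f.toAddMonoidHom)
  map_add' _ _ := rfl
  map_smul' r χ := Char.ext fun m => congrArg χ (map_smul f r.unop m).symm

@[simp] theorem Char.map_apply {M N : Type u} [AddCommGroup M] [Module R M] [AddCommGroup N]
    [Module R N] (f : M →ₗ[R] N) (χ : Char N) (m : M) : Char.map f χ m = χ (f m) := rfl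

/-- The left module homomorphism `N^+ → M^+` given by precomposition with a homomorphism
`f : M → N` of right modules. -/
def Char.opMap {M N : Type u} [AddCommGroup M] [Module Rᵐᵒᵖ M] [AddCommGroup N] [Module Rᵐᵒᵖ N]
    (f : M →ₗ[Rᵐᵒᵖ] N) : Char N →ₗ[R] Char M where
  toFun χ := Char.mk (AddMonoidHom.comp χ f.toAddMonoidHom)
  map_add' _ _ := rfl
  map_smul' r χ := Char.ext fun m => congrArg χ (map_smul f (MulOpposite.op r) m).symm

/-- The evaluation homomorphism of a left module into its double character module. -/
def Char.eval (M : Type u) [AddCommGroup M] [Module R M] : M →ₗ[R] Char (Char M) where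
  toFun m := Char.mk
    { toFun := fun χ => χ m
      map_zero' := rfl
      map_add' := fun _ _ => rfl }
  map_add' m m' := Char.ext fun χ => map_add χ m m'
  map_smul' _ _ := rfl

@[simp] theorem Char.eval_apply {M : Type u} [AddCommGroup M] [Module R M] (m : M) (χ : Char M) :
    Char.eval (R := R) M m χ = χ m := rfl

/-- The evaluation homomorphism of a right module into its double character module. -/
def Char.opEval (M : Type u) [AddCommGroup M] [Module Rᵐᵒᵖ M] : M →ₗ[Rᵐᵒᵖ] Char (Char M) where
  toFun m := Char.mk
    { toFun := fun χ => χ m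
      map_zero' := rfl
      map_add' := fun _ _ => rfl }
  map_add' m m' := Char.ext fun χ => map_add χ m m'
  map_smul' _ _ := rfl

@[simp] theorem Char.opEval_apply {M : Type u} [AddCommGroup M] [Module Rᵐᵒᵖ M] (m : M)
    (χ : Char M) : Char.opEval (R := R) M m χ = χ m := rfl

theorem Char.eval_injective (M : Type u) [AddCommGroup M] [Module R M] :
    Function.Injective (Char.eval (R := R) M) := by
  rw [injective_iff_map_eq_zero]
  intro m hm
  by_contra h
  obtain ⟨χ, -, hχ⟩ := Char.exists_ne_zero (⊥ : AddSubgroup M) (a := m) (by simpa using h)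
  exact hχ (DFunLike.congr_fun hm χ)

/-- A module is pure in its double character module. If a system with right-hand sides `h`
has no solution in `M`, then some character of `W → M`, that is, a family of characters of `M`,
separates `h` from the solvable right-hand sides, and a solution in `M^{++}`, evaluated at this
family, gives a contradiction. -/
theorem Char.isPure_eval (M : Type u) [AddCommGroup M] [Module R M] :
    IsPure (Char.eval (R := R) M) := by
  classical
  intro V W _ _ b f hf
  have := Fintype.ofFinite V
  have := Fintype.ofFinite W
  choose h hh using hf
  let H : AddSubgroup (W → M) := AddMonoidHom.range
    (AddMonoidHom.mk' (fun (t : (V →₀ R) →ₗ[R] M) w => t (b w)) fun _ _ => rfl)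
  by_cases hH : h ∈ H
  · obtain ⟨t, ht⟩ := hH
    exact ⟨t, fun w => by rw [← hh, ← ht]; rfl⟩
  exfalso
  obtain ⟨χ, hχ0, hχ⟩ := Char.exists_ne_zero H hH
  apply hχ
  let c : W → Char M := fun w => Char.mk
    (AddMonoidHom.comp χ (AddMonoidHom.single (fun _ : W => M) w))
  have hc : ∀ g : W → M, χ g = ∑ w, c w (g w) := fun g => by
    conv_lhs => rw [← Finset.univ_sum_single g, map_sum]
    rfl
  have hzero : ∀ v, ∑ w, MulOpposite.op (b w v) • c w = 0 := by
    intro v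
    ext x
    have := hχ0 _ ⟨LinearMap.toSpanSingleton R M x ∘ₗ Finsupp.lapply v, rfl⟩
    rw [hc] at this
    rw [Char.sum_apply]
    exact this
  have hfb : ∀ w, f (b w) = ∑ v, b w v • f (Finsupp.single v 1) := fun w => by
    conv_lhs => rw [← Finsupp.univ_sum_single (b w), map_sum]
    refine Finset.sum_congr rfl fun v _ => ?_
    rw [← map_smul, Finsupp.smul_single, smul_eq_mul, mul_one]
  calc χ h = ∑ w, f (b w) (c w) := by
        rw [hc]; exact Finset.sum_congr rfl fun w _ => by rw [← hh]; rfl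
    _ = ∑ w, ∑ v, f (Finsupp.single v 1) (MulOpposite.op (b w v) • c w) := by
        refine Finset.sum_congr rfl fun w _ => ?_
        rw [hfb, Char.sum_apply]
        rfl
    _ = ∑ v, f (Finsupp.single v 1) (∑ w, MulOpposite.op (b w v) • c w) := by
        rw [Finset.sum_comm]
        exact Finset.sum_congr rfl fun v _ => (map_sum _ _ _).symm
    _ = 0 := by simp [hzero]

/-- The terms `F 0, D 0, D 1, …` of a complex spliced from short exact sequences
`0 → F k → D k → F (k + 1) → 0`. -/
def spliceObj (F D : ℕ → ModuleCat.{u} R) : ℕ → ModuleCat.{u} R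
  | 0 => F 0
  | k + 1 => D k

/-- The differentials of the complex spliced from short exact sequences
`0 → F k → D k → F (k + 1) → 0`. -/
def spliceMap {F D : ℕ → ModuleCat.{u} R} (i : ∀ k, F k →ₗ[R] D k) (p : ∀ k, D k →ₗ[R] F (k + 1)) :
    ∀ k, spliceObj F D k →ₗ[R] spliceObj F D (k + 1)
  | 0 => i 0
  | k + 1 => i (k + 1) ∘ₗ p k

/-- Splicing short exact sequences `0 → F k → D k → F (k + 1) → 0` with pure monomorphisms gives a
pure exact complex `0 → F 0 → D 0 → D 1 → ⋯`. -/
theorem isPureExact_splice {F D : ℕ → ModuleCat.{u} R} {i : ∀ k, F k →ₗ[R] D k}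
    {p : ∀ k, D k →ₗ[R] F (k + 1)} (hi : ∀ k, Function.Injective (i k))
    (hpure : ∀ k, IsPure (i k)) (hp : ∀ k, Function.Surjective (p k))
    (hex : ∀ k, Function.Exact (i k) (p k)) : IsPureExact (spliceMap i p) where
  injective := hi 0
  comp_eq_zero k x := by
    cases k with
    | zero => exact (congrArg (i 1) ((hex 0).apply_apply_eq_zero x)).trans (map_zero _)
    | succ k =>
      exact (congrArg (i (k + 2)) ((hex (k + 1)).apply_apply_eq_zero (p k x))).trans (map_zero _)
  solve k V W _ _ b f hf := by
    obtain ⟨t, ht⟩ := hpure k V W b f fun w =>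
      (hex k _).1 (hi (k + 1) ((hf w).trans (map_zero _).symm))
    cases k with
    | zero => exact ⟨t, ht⟩
    | succ k =>
      obtain ⟨t', ht'⟩ := Module.projective_lifting_property (p k) t (hp k)
      exact ⟨t', fun w => (congrArg (i (k + 1)) (LinearMap.congr_fun ht' (b w))).trans (ht w)⟩

end Characters

/-! ### Hom-tensor adjunction -/

section Tensor

variable {R : Type u} [Ring R] {M N : Type u} [AddCommGroup M] [Module Rᵐᵒᵖ M] [AddCommGroup N]
  [Module R N]

/-- The homomorphism `M ⊗_R N → A` induced by a balanced biadditive map. -/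
def tensorLift {A : Type*} [AddCommGroup A] (β : M → N → A)
    (h₁ : ∀ m m' n, β (m + m') n = β m n + β m' n)
    (h₂ : ∀ m n n', β m (n + n') = β m n + β m n')
    (h : ∀ m (r : R) n, β (MulOpposite.op r • m) n = β m (r • n)) : Tensor R M N →+ A :=
  QuotientAddGroup.lift (tensorRel R M N)
    (TensorProduct.liftAddHom (AddMonoidHom.mk' (fun m => AddMonoidHom.mk' (β m) (h₂ m))
      fun m m' => AddMonoidHom.ext fun n => h₁ m m' n) fun z m n => by
        rw [map_zsmul, AddMonoidHom.zsmul_apply, map_zsmul]) <| by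
      refine (AddSubgroup.closure_le _).2 ?_
      rintro _ ⟨m, r, n, rfl⟩
      simp [h]

theorem tmul_add_right (m : M) (n n' : N) : tmul R m (n + n') = tmul R m n + tmul R m n' := by
  simp [tmul, TensorProduct.tmul_add]

theorem smul_tmul (m : M) (r : R) (n : N) : tmul R (MulOpposite.op r • m) n = tmul R m (r • n) := by
  refine sub_eq_zero.1 ((QuotientAddGroup.eq_zero_iff _).2 (AddSubgroup.subset_closure ?_))
  exact ⟨m, r, n, rfl⟩

variable (R) in
/-- The biadditive map `m ↦ n ↦ m ⊗ n`. -/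
def tmulHom (M N : Type u) [AddCommGroup M] [Module Rᵐᵒᵖ M] [AddCommGroup N] [Module R N] :
    M →+ N →+ Tensor R M N :=
  AddMonoidHom.mk' (fun m => AddMonoidHom.mk' (tmul R m) (tmul_add_right m)) fun m m' =>
    AddMonoidHom.ext fun n => tmul_add_left R m m' n

@[simp] theorem tmulHom_apply (m : M) (n : N) : tmulHom R M N m n = tmul R m n := rfl

/-- Hom-tensor adjunction: `Hom_R(N, M^+)` is the group of characters of `M ⊗_R N`. -/
def homCharEquiv : (N →ₗ[R] Char M) ≃ Char (Tensor R M N) where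
  toFun f := Char.mk <| tensorLift (R := R) (fun m n => f n m) (fun m m' n => map_add (f n) m m')
    (fun m n n' => by rw [map_add, Char.add_apply])
    (fun m r n => by rw [map_smul f, Char.smul_apply])
  invFun χ :=
    { toFun := fun n => Char.mk (AddMonoidHom.comp χ ((tmulHom R M N).flip n))
      map_add' := fun n n' => Char.ext fun m =>
        (congrArg χ (tmul_add_right m n n')).trans (map_add χ _ _)
      map_smul' := fun r n => Char.ext fun m => (congrArg χ (smul_tmul m r n)).symm }
  left_inv _ := rfl
  right_inv χ := tensor_hom_ext (R := R) (g := χ) fun _ _ => rfl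

/-- Hom-tensor adjunction: `Hom_{R^op}(M, N^+)` is the group of characters of `M ⊗_R N`. -/
def opHomCharEquiv : (M →ₗ[Rᵐᵒᵖ] Char N) ≃ Char (Tensor R M N) where
  toFun f := Char.mk <| tensorLift (R := R) (fun m n => f m n)
    (fun m m' n => by rw [map_add, Char.add_apply]) (fun m n n' => map_add (f m) n n')
    (fun m r n => by rw [map_smul f, Char.op_smul_apply, MulOpposite.unop_op])
  invFun χ :=
    { toFun := fun m => Char.mk (AddMonoidHom.comp χ (tmulHom R M N m))
      map_add' := fun m m' => Char.ext fun n =>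
        (congrArg χ (tmul_add_left R m m' n)).trans (map_add χ _ _)
      map_smul' := fun r m => Char.ext fun n => congrArg χ (smul_tmul m r.unop n) }
  left_inv _ := rfl
  right_inv χ := tensor_hom_ext (R := R) (g := χ) fun _ _ => rfl

theorem Char.tensor_ext {χ ψ : Char (Tensor R M N)} (h : ∀ m n, χ (tmul R m n) = ψ (tmul R m n)) :
    χ = ψ :=
  tensor_hom_ext (R := R) (f := χ) (g := ψ) h

/-- `M ⊗_R -` takes a complex to an exact one if and only if `Hom_R(-, M^+)` does. -/
theorem tensorMap_left_exact_iff {N₀ N₁ N₂ : Type u} [AddCommGroup N₀] [Module R N₀]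
    [AddCommGroup N₁] [Module R N₁] [AddCommGroup N₂] [Module R N₂] (f : N₂ →ₗ[R] N₁)
    (g : N₁ →ₗ[R] N₀) (hgf : ∀ x, g (f x) = 0) :
    Function.Exact (tensorMap (LinearMap.id : M →ₗ[Rᵐᵒᵖ] M) f)
        (tensorMap (LinearMap.id : M →ₗ[Rᵐᵒᵖ] M) g) ↔
      ∀ y : N₁ →ₗ[R] Char M, (∀ x, y (f x) = 0) → ∃ z : N₀ →ₗ[R] Char M, ∀ x, z (g x) = y x := by
  have h0 : ∀ m : M, tmul R m (0 : N₀) = 0 := fun m => map_zero (tmulHom R M N₀ m)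
  rw [exact_iff_char]
  · refine (homCharEquiv.forall_congr fun y => imp_congr ?_ (homCharEquiv.exists_congr
      fun z => ?_)).symm
    · refine ⟨fun h => DFunLike.congr_fun (Char.tensor_ext
        (χ := Char.mk (AddMonoidHom.comp (homCharEquiv y) (tensorMap LinearMap.id f))) (ψ := 0)
        fun m n => DFunLike.congr_fun (h n) m), fun h n => Char.ext fun m => h (tmul R m n)⟩
    · refine ⟨fun h => DFunLike.congr_fun (Char.tensor_ext
        (χ := Char.mk (AddMonoidHom.comp (homCharEquiv z) (tensorMap LinearMap.id g)))
        (ψ := homCharEquiv y)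
        fun m n => DFunLike.congr_fun (h n) m), fun h n => Char.ext fun m => h (tmul R m n)⟩
  · refine DFunLike.congr_fun (tensor_hom_ext (f := (tensorMap LinearMap.id g).comp
      (tensorMap LinearMap.id f)) (g := 0) fun m n => ?_)
    exact (congrArg (tmul R m) (hgf n)).trans (h0 m)

/-- `- ⊗_R N` takes a complex to an exact one if and only if `Hom_{R^op}(-, N^+)` does. -/
theorem tensorMap_right_exact_iff {M₀ M₁ M₂ : Type u} [AddCommGroup M₀] [Module Rᵐᵒᵖ M₀]
    [AddCommGroup M₁] [Module Rᵐᵒᵖ M₁] [AddCommGroup M₂] [Module Rᵐᵒᵖ M₂] (f : M₂ →ₗ[Rᵐᵒᵖ] M₁)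
    (g : M₁ →ₗ[Rᵐᵒᵖ] M₀) (hgf : ∀ x, g (f x) = 0) :
    Function.Exact (tensorMap f (LinearMap.id : N →ₗ[R] N))
        (tensorMap g (LinearMap.id : N →ₗ[R] N)) ↔
      ∀ y : M₁ →ₗ[Rᵐᵒᵖ] Char N, (∀ x, y (f x) = 0) →
        ∃ z : M₀ →ₗ[Rᵐᵒᵖ] Char N, ∀ x, z (g x) = y x := by
  have h0 : ∀ n : N, tmul R (0 : M₀) n = 0 := fun n => map_zero ((tmulHom R M₀ N).flip n)
  rw [exact_iff_char]
  · refine (opHomCharEquiv.forall_congr fun y => imp_congr ?_ (opHomCharEquiv.exists_congr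
      fun z => ?_)).symm
    · refine ⟨fun h => DFunLike.congr_fun (Char.tensor_ext
        (χ := Char.mk (AddMonoidHom.comp (opHomCharEquiv y) (tensorMap f LinearMap.id))) (ψ := 0)
        fun m n => DFunLike.congr_fun (h m) n), fun h m => Char.ext fun n => h (tmul R m n)⟩
    · refine ⟨fun h => DFunLike.congr_fun (Char.tensor_ext
        (χ := Char.mk (AddMonoidHom.comp (opHomCharEquiv z) (tensorMap g LinearMap.id)))
        (ψ := opHomCharEquiv y)
        fun m n => DFunLike.congr_fun (h m) n), fun h m => Char.ext fun n => h (tmul R m n)⟩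
  · refine DFunLike.congr_fun (tensor_hom_ext (f := (tensorMap g LinearMap.id).comp
      (tensorMap f LinearMap.id)) (g := 0) fun m n => ?_)
    exact (congrArg (fun x => tmul R x n) (hgf m)).trans (h0 n)

end Tensor

/-! ### Ext and Tor over resolutions by finitely generated projective modules -/

section FiniteProjective

variable {R : Type u} [Ring R] {P I : Type u} [AddCommGroup P] [Module Rᵐᵒᵖ P] [AddCommGroup I]
  [Module Rᵐᵒᵖ I]

variable (R P I) in
/-- The natural map `P ⊗_R I^+ → Hom_{R^op}(P, I)^+`, `p ⊗ χ ↦ (u ↦ χ (u p))`. -/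
def tensorCharHom : Tensor R P (Char I) →+ Char (P →ₗ[Rᵐᵒᵖ] I) :=
  tensorLift (R := R)
    (fun p χ => Char.mk (AddMonoidHom.mk' (fun u : P →ₗ[Rᵐᵒᵖ] I => χ (u p)) fun u v =>
      map_add χ (u p) (v p)))
    (fun p p' χ => Char.ext fun u => (congrArg χ (map_add u p p')).trans (map_add χ _ _))
    (fun _ _ _ => rfl)
    (fun p r χ => Char.ext fun u => congrArg χ (map_smul u (MulOpposite.op r) p))

theorem tensorCharHom_tensorMap {P' : Type u} [AddCommGroup P'] [Module Rᵐᵒᵖ P']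
    (f : P →ₗ[Rᵐᵒᵖ] P') (x : Tensor R P (Char I)) (u : P' →ₗ[Rᵐᵒᵖ] I) :
    tensorCharHom R P' I (tensorMap f LinearMap.id x) u = tensorCharHom R P I x (u ∘ₗ f) :=
  DFunLike.congr_fun (tensor_hom_ext (R := R)
    (f := AddMonoidHom.mk' (fun x => tensorCharHom R P' I (tensorMap f LinearMap.id x) u)
      fun x y => by rw [map_add, map_add, Char.add_apply])
    (g := AddMonoidHom.mk' (fun x => tensorCharHom R P I x (u ∘ₗ f))
      fun x y => by rw [map_add, Char.add_apply])
    fun _ _ => rfl) x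

/-- For a finitely generated projective module, a dual basis provides the inverse of
`P ⊗_R I^+ → Hom_{R^op}(P, I)^+`. -/
theorem tensorCharHom_bijective [Module.Finite Rᵐᵒᵖ P] [Module.Projective Rᵐᵒᵖ P] :
    Function.Bijective (tensorCharHom R P I) := by
  obtain ⟨n, f, g, -, -, hfg⟩ := Module.Finite.exists_comp_eq_id_of_projective Rᵐᵒᵖ P
  let e : Fin n → P := fun j => f (Pi.single j 1)
  have he : ∀ p, ∑ j, g p j • e j = p := fun p => by
    have h1 := LinearMap.congr_fun hfg p
    have h2 : g p = ∑ j, g p j • (Pi.single j 1 : Fin n → Rᵐᵒᵖ) := by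
      ext j
      simp [Finset.sum_apply, Pi.single_apply]
    conv_rhs => rw [← LinearMap.id_apply (R := Rᵐᵒᵖ) p, ← h1, LinearMap.comp_apply, h2]
    simp [e]
  let c : Fin n → I →+ (P →ₗ[Rᵐᵒᵖ] I) := fun j =>
    AddMonoidHom.mk' (fun x => LinearMap.toSpanSingleton Rᵐᵒᵖ I x ∘ₗ LinearMap.proj j ∘ₗ g)
      fun x y => by ext; simp
  let inv : Char (P →ₗ[Rᵐᵒᵖ] I) →+ Tensor R P (Char I) := ∑ j, (tmulHom R P (Char I) (e j)).comp
    (AddMonoidHom.mk' (fun Φ => Char.mk (AddMonoidHom.comp Φ (c j))) fun _ _ => rfl)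
  have hinv : ∀ Φ, inv Φ = ∑ j, tmul R (e j) (Char.mk (AddMonoidHom.comp Φ (c j))) := fun Φ => by
    simp only [inv, AddMonoidHom.finsetSum_apply]
    rfl
  have hleft : ∀ x, inv (tensorCharHom R P I x) = x :=
    DFunLike.congr_fun (tensor_hom_ext (R := R) (f := inv.comp (tensorCharHom R P I))
      (g := AddMonoidHom.id _) fun p χ => by
        simp only [AddMonoidHom.comp_apply, hinv, AddMonoidHom.id_apply]
        conv_rhs => rw [← he p, ← tmulHom_apply, map_sum, AddMonoidHom.finsetSum_apply]
        exact Finset.sum_congr rfl fun j _ => (smul_tmul (e j) (g p j).unop χ).symm)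
  refine ⟨Function.LeftInverse.injective hleft, fun Φ => ⟨inv Φ, ?_⟩⟩
  ext u
  rw [hinv, map_sum, Char.sum_apply]
  calc _ = ∑ j, Φ (c j (u (e j))) := rfl
    _ = Φ (∑ j, c j (u (e j))) := (map_sum Φ _ _).symm
    _ = Φ u := by
      congr 1
      ext p
      conv_rhs => rw [← he p, map_sum]
      simp [c, LinearMap.sum_apply]

end FiniteProjective

section Resolutions

theorem isAbsolutelyClean_iff {S : Type u} [Ring S] (N : ModuleCat.{u} S) :
    IsAbsolutelyClean N ↔ ∀ (M : ModuleCat.{u} S) (P : ProjectiveResolution M),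
      (∀ n, Module.Finite S (P.complex.X n)) → ∀ y : P.complex.X 1 →ₗ[S] N,
        (∀ x, y ((P.complex.d 2 1).hom x) = 0) →
          ∃ z : P.complex.X 0 →ₗ[S] N, ∀ x, z ((P.complex.d 1 0).hom x) = y x := by
  constructor
  · intro h M P hP y hy
    have := h M ⟨P, hP⟩
    have hy' : P.complex.d 2 1 ≫ ModuleCat.ofHom y = 0 :=
      ModuleCat.hom_ext (LinearMap.ext hy)
    obtain ⟨z, hz⟩ := (P.extMk_eq_zero_iff (ModuleCat.ofHom y) 2 rfl hy' 0 rfl).1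
      (Subsingleton.elim _ _)
    exact ⟨z.hom, fun x => LinearMap.congr_fun (congrArg ModuleCat.Hom.hom hz) x⟩
  · rintro h M ⟨P, hP⟩
    refine subsingleton_of_forall_eq 0 fun α => ?_
    obtain ⟨y, hy, rfl⟩ := P.extMk_surjective α 2 rfl
    obtain ⟨z, hz⟩ := h M P hP y.hom fun x => LinearMap.congr_fun (congrArg ModuleCat.Hom.hom hy) x
    exact (P.extMk_eq_zero_iff y 2 rfl hy 0 rfl).2
      ⟨ModuleCat.ofHom z, ModuleCat.hom_ext (LinearMap.ext hz)⟩

variable {R : Type u} [Ring R]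

theorem subsingleton_tor_one_iff {M : ModuleCat.{u} Rᵐᵒᵖ} (P : ProjectiveResolution M)
    (N : ModuleCat.{u} R) :
    Subsingleton (tor R 1 M N) ↔
      Function.Exact (tensorMap (P.complex.d 2 1).hom (LinearMap.id : N →ₗ[R] N))
        (tensorMap (P.complex.d 1 0).hom (LinearMap.id : N →ₗ[R] N)) := by
  have e := P.isoLeftDerivedObj (tensorRight R N) 1
  have h1 : Subsingleton (tor R 1 M N) ↔ Limits.IsZero (tor R 1 M N) :=
    ⟨fun _ => AddCommGrpCat.isZero_of_subsingleton _,
      fun h => AddCommGrpCat.subsingleton_of_isZero h⟩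
  rw [h1, tor, e.isZero_iff]
  change Limits.IsZero (HomologicalComplex.homology _ 1) ↔ _
  rw [← HomologicalComplex.exactAt_iff_isZero_homology,
    HomologicalComplex.exactAt_iff' _ 2 1 0 (by simp) (by simp),
    ShortComplex.ab_exact_iff_function_exact]
  rfl

theorem d_d_apply_of_projectiveResolution {S : Type u} [Ring S] {M : ModuleCat.{u} S}
    (P : ProjectiveResolution M) (x : P.complex.X 2) :
    (P.complex.d 1 0).hom ((P.complex.d 2 1).hom x) = 0 :=
  LinearMap.congr_fun (congrArg ModuleCat.Hom.hom (P.complex.d_comp_d 2 1 0)) x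

theorem projective_of_projectiveResolution {S : Type u} [Ring S] {M : ModuleCat.{u} S}
    (P : ProjectiveResolution M) (n : ℕ) : Module.Projective S (P.complex.X n) :=
  (IsProjective.iff_projective _).2 (P.projective n)

/-- A left module is level if and only if its character module is absolutely clean, because
`Ext^1(M, F^+)` is the character group of `Tor_1(M, F)`. -/
theorem isLevel_iff_char (F : ModuleCat.{u} R) :
    IsLevel F ↔ IsAbsolutelyClean (ModuleCat.of Rᵐᵒᵖ (Char F)) := by
  rw [isAbsolutelyClean_iff]
  have key : ∀ {M : ModuleCat.{u} Rᵐᵒᵖ} (P : ProjectiveResolution M), _ := fun P =>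
    (subsingleton_tor_one_iff P F).trans
      (tensorMap_right_exact_iff _ _ (d_d_apply_of_projectiveResolution P))
  exact ⟨fun h M P hP => (key P).1 (h M ⟨P, hP⟩), fun h M ⟨P, hP⟩ => (key P).2 (h M P hP)⟩

/-- The character module of an absolutely clean right module is level: if `M` has a resolution by
finitely generated projective modules, then `Tor_1(M, I^+)` is the character group of
`Ext^1(M, I)`. -/
theorem IsAbsolutelyClean.isLevel_char {I : ModuleCat.{u} Rᵐᵒᵖ} (hI : IsAbsolutelyClean I) :
    IsLevel (ModuleCat.of R (Char I)) := by
  rw [isAbsolutelyClean_iff] at hI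
  rintro M ⟨P, hP⟩
  rw [subsingleton_tor_one_iff P]
  have := projective_of_projectiveResolution P
  set d₁ := (P.complex.d 1 0).hom
  set d₂ := (P.complex.d 2 1).hom
  have hd : ∀ x, d₁ (d₂ x) = 0 := d_d_apply_of_projectiveResolution P
  let α : (P.complex.X 0 →ₗ[Rᵐᵒᵖ] I) →+ (P.complex.X 1 →ₗ[Rᵐᵒᵖ] I) :=
    AddMonoidHom.mk' (fun u => u ∘ₗ d₁) fun u v => LinearMap.add_comp _ _ _
  let β : (P.complex.X 1 →ₗ[Rᵐᵒᵖ] I) →+ (P.complex.X 2 →ₗ[Rᵐᵒᵖ] I) :=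
    AddMonoidHom.mk' (fun u => u ∘ₗ d₂) fun u v => LinearMap.add_comp _ _ _
  have hβα : ∀ u, β (α u) = 0 := fun u =>
    LinearMap.ext fun x => (congrArg u (hd x)).trans (map_zero u)
  have hexact : Function.Exact α β := fun y => by
    refine ⟨fun hy => ?_, fun ⟨u, hu⟩ => hu ▸ hβα u⟩
    obtain ⟨z, hz⟩ := hI M P hP y (LinearMap.congr_fun hy)
    exact ⟨z, LinearMap.ext hz⟩
  intro x
  constructor
  · intro hx
    obtain ⟨ψ, hψ⟩ := (exact_iff_char α β hβα).1 hexact (tensorCharHom R _ I x) fun u => by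
      change tensorCharHom R _ I x (u ∘ₗ d₁) = 0
      rw [← tensorCharHom_tensorMap]
      exact congrArg (fun t => tensorCharHom R _ I t u) hx
    obtain ⟨y, hy⟩ := (tensorCharHom_bijective (R := R) (P := P.complex.X 2) (I := I)).2 ψ
    refine ⟨y, (tensorCharHom_bijective (R := R) (P := P.complex.X 1) (I := I)).1 ?_⟩
    ext u
    rw [← hψ u, ← hy]
    exact tensorCharHom_tensorMap d₂ y u
  · rintro ⟨y, rfl⟩
    apply (tensorCharHom_bijective (R := R) (P := P.complex.X 0) (I := I)).1
    ext u
    refine (tensorCharHom_tensorMap d₁ _ u).trans ((tensorCharHom_tensorMap d₂ y _).trans ?_)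
    exact (congrArg (tensorCharHom R _ I y) (hβα u)).trans (map_zero _)

theorem IsLevel.char_char {F : ModuleCat.{u} R} (hF : IsLevel F) :
    IsLevel (ModuleCat.of R (Char (Char F))) :=
  ((isLevel_iff_char F).1 hF).isLevel_char

/-- `F^{++}/F` is level if `F` is: its character module is a direct summand of `F^{+++}`,
with complement `F^+`. -/
theorem IsLevel.char_char_quotient {F : ModuleCat.{u} R} (hF : IsLevel F) :
    IsLevel (ModuleCat.of R (Char (Char F) ⧸ LinearMap.range (Char.eval (R := R) F))) := by
  have h := (isLevel_iff_char _).1 hF.char_char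
  rw [isLevel_iff_char]
  rw [isAbsolutelyClean_iff] at h ⊢
  intro M P hP y hy
  let E := LinearMap.range (Char.eval (R := R) F)
  let j : Char (Char (Char F) ⧸ E) →ₗ[Rᵐᵒᵖ] Char (Char (Char F)) := Char.map E.mkQ
  let q : Char (Char (Char F)) →ₗ[Rᵐᵒᵖ] Char (Char (Char F)) :=
    LinearMap.id - Char.opEval (R := R) (Char F) ∘ₗ Char.map (Char.eval F)
  have hq : ∀ ζ, ∀ ξ ∈ E, q ζ ξ = 0 := by
    rintro ζ _ ⟨x, rfl⟩
    simp [q]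
  -- `q` is the projection killing the copy of `F^+`; its values vanish on `F`, so it descends to a
  -- retraction `r` of `j`.
  let r : Char (Char (Char F)) →ₗ[Rᵐᵒᵖ] Char (Char (Char F) ⧸ E) :=
    { toFun := fun ζ => Char.mk (QuotientAddGroup.lift E.toAddSubgroup (q ζ) (hq ζ))
      map_add' := fun ζ ζ' => Char.ext fun ξ => by
        obtain ⟨ξ, rfl⟩ := E.mkQ_surjective ξ
        exact DFunLike.congr_fun (map_add q ζ ζ') ξ
      map_smul' := fun a ζ => Char.ext fun ξ => by
        obtain ⟨ξ, rfl⟩ := E.mkQ_surjective ξ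
        exact DFunLike.congr_fun (map_smul q a ζ) ξ }
  have hrj : ∀ χ, r (j χ) = χ := fun χ => Char.ext fun ξ => by
    obtain ⟨ξ, rfl⟩ := E.mkQ_surjective ξ
    change j χ ξ - ξ (Char.map (Char.eval F) (j χ)) = χ (E.mkQ ξ)
    have : Char.map (Char.eval (R := R) F) (j χ) = 0 := Char.ext fun x => by
      have hx : E.mkQ (Char.eval F x) = 0 := (Submodule.Quotient.mk_eq_zero _).2 ⟨x, rfl⟩
      exact (congrArg χ hx).trans (map_zero χ)
    rw [this, map_zero, sub_zero]
    rfl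
  obtain ⟨z, hz⟩ := h M P hP (j ∘ₗ y) fun x => (congrArg j (hy x)).trans (map_zero j)
  exact ⟨r ∘ₗ z, fun x => (congrArg r (hz x)).trans (hrj _)⟩

/-- A projective left module is level. By the hom-tensor adjunctions this amounts to lifting
maps out of `F` along the exact sequence of character modules of a resolution. -/
theorem isLevel_of_projective (F : ModuleCat.{u} R) [Module.Projective R F] : IsLevel F := by
  rintro M ⟨P, -⟩
  rw [subsingleton_tor_one_iff P,
    tensorMap_right_exact_iff _ _ (d_d_apply_of_projectiveResolution P)]
  intro y hy
  let d : P.complex.X 1 →ₗ[Rᵐᵒᵖ] P.complex.X 0 := (P.complex.d 1 0).hom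
  let f : F →ₗ[R] Char (P.complex.X 1) := homCharEquiv.symm (opHomCharEquiv y)
  have hf : ∀ n, f n ∈ LinearMap.range (Char.opMap (R := R) d) := fun n => by
    obtain ⟨ψ, hψ⟩ := (exact_iff_char (P.complex.d 2 1).hom.toAddMonoidHom d.toAddMonoidHom
      (d_d_apply_of_projectiveResolution P)).1
      ((ShortComplex.ShortExact.moduleCat_exact_iff_function_exact _).1 (P.exact_succ 0)) (f n)
      fun x => DFunLike.congr_fun (hy x) n
    exact ⟨ψ, Char.ext hψ⟩
  obtain ⟨z, hz⟩ := Module.projective_lifting_property (Char.opMap (R := R) d).rangeRestrict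
    (f.codRestrict _ hf) (LinearMap.surjective_rangeRestrict _)
  refine ⟨opHomCharEquiv.symm (homCharEquiv z), fun x => Char.ext fun n => ?_⟩
  exact DFunLike.congr_fun (congrArg Subtype.val (LinearMap.congr_fun hz n)) x

end Resolutions

/-! ### Exactness of tensor and Hom complexes -/

section Complexes

variable {R : Type u} [Ring R] {C : ChainComplex (ModuleCat.{u} R) ℤ}

theorem d_d_apply (C : ChainComplex (ModuleCat.{u} R) ℤ) (i j k : ℤ) (x : C.X i) :
    (C.d j k).hom ((C.d i j).hom x) = 0 :=
  LinearMap.congr_fun (congrArg ModuleCat.Hom.hom (C.d_comp_d i j k)) x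

theorem homExact_iff (F : ModuleCat.{u} R) : HomExact C F ↔
    ∀ n : ℤ, ∀ y : C.X n →ₗ[R] F, (∀ x, y ((C.d (n + 1) n).hom x) = 0) →
      ∃ z : C.X (n - 1) →ₗ[R] F, ∀ x, z ((C.d n (n - 1)).hom x) = y x := by
  refine forall_congr' fun n => ⟨fun h y hy => ?_, fun h y => ⟨fun hy => ?_, ?_⟩⟩
  · obtain ⟨z, hz⟩ := (h (ModuleCat.ofHom y)).1 (ModuleCat.hom_ext (LinearMap.ext hy))
    exact ⟨z.hom, fun x => LinearMap.congr_fun (congrArg ModuleCat.Hom.hom hz) x⟩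
  · obtain ⟨z, hz⟩ := h y.hom fun x => LinearMap.congr_fun (congrArg ModuleCat.Hom.hom hy) x
    exact ⟨ModuleCat.ofHom z, ModuleCat.hom_ext (LinearMap.ext hz)⟩
  · rintro ⟨z, rfl⟩
    change C.d (n + 1) n ≫ C.d n (n - 1) ≫ z = _
    rw [← Category.assoc, C.d_comp_d, Limits.zero_comp]

/-- A form of exactness of `Hom_R(C, F)` with flexible indices. -/
theorem HomExact.exists_extend {F : ModuleCat.{u} R} (h : HomExact C F) {i j k : ℤ}
    (hij : i = j + 1) (hjk : k = j - 1) (y : C.X j →ₗ[R] F)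
    (hy : ∀ x, y ((C.d i j).hom x) = 0) :
    ∃ z : C.X k →ₗ[R] F, ∀ x, z ((C.d j k).hom x) = y x := by
  subst hij hjk
  exact (homExact_iff F).1 h j y hy

theorem tensorExact_iff_homExact_char (I : ModuleCat.{u} Rᵐᵒᵖ) :
    TensorExact I C ↔ HomExact C (ModuleCat.of R (Char I)) := by
  rw [homExact_iff]
  exact forall_congr' fun n => tensorMap_left_exact_iff _ _ (d_d_apply C _ _ _)

theorem IsFirmlyAcyclic.isACAcyclic (h : IsFirmlyAcyclic C) : IsACAcyclic C := fun I hI =>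
  (tensorExact_iff_homExact_char I).2 (h _ hI.isLevel_char)

/-- If `C` is a complex of projective modules, then `Hom_R(C, F)` is exact as soon as
`F` has a pure coresolution `F = F 0 → D 0 → D 1 → ⋯`, spliced from short exact sequences
`0 → F k → D k → F (k + 1) → 0`, such that all `Hom_R(C, D k)` are exact. A cocycle `y : C n → F`
extends to a chain map `g` from the part of `C` in degrees below `n` to the complex of the `D k`,
and a null-homotopy of `g` contains a map `C (n - 1) → F` that extends `y`. -/
theorem homExact_of_pure_coresolution (hC : ∀ n, Module.Projective R (C.X n))
    {F D : ℕ → ModuleCat.{u} R} {i : ∀ k, F k →ₗ[R] D k} {p : ∀ k, D k →ₗ[R] F (k + 1)}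
    (hi : ∀ k, Function.Injective (i k)) (hpure : ∀ k, IsPure (i k))
    (hp : ∀ k, Function.Surjective (p k)) (hex : ∀ k, Function.Exact (i k) (p k))
    (hD : ∀ k, HomExact C (D k)) : HomExact C (F 0) := by
  rw [homExact_iff]
  intro n y hy
  -- Each `g k` lives on `C.X (n - 1 - k)`; its composite with `p k` vanishes on boundaries.
  let G : ℕ → Type u := fun k => {g : C.X (n - 1 - (k : ℤ)) →ₗ[R] D k //
    ∀ x, p k (g ((C.d (n - (k : ℤ)) (n - 1 - (k : ℤ))).hom x)) = 0}
  have hG0 : ∃ g : G 0, ∀ x, g.1 ((C.d n (n - 1 - ((0 : ℕ) : ℤ))).hom x) = i 0 (y x) := by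
    obtain ⟨g, hg⟩ := (hD 0).exists_extend (i := n + 1) (k := n - 1 - ((0 : ℕ) : ℤ)) rfl (by simp)
      (i 0 ∘ₗ y) fun x => (congrArg (i 0) (hy x)).trans (map_zero _)
    have hg' : ∀ m (h : m = n) x, p 0 (g ((C.d m (n - 1 - ((0 : ℕ) : ℤ))).hom x)) = 0 := by
      rintro _ rfl x
      rw [hg]
      exact (hex 0).apply_apply_eq_zero _
    exact ⟨⟨g, hg' _ (by simp)⟩, hg⟩
  have hG : ∀ k (g : G k), ∃ g' : G (k + 1), ∀ x,
      g'.1 ((C.d (n - 1 - (k : ℤ)) (n - 1 - ((k + 1 : ℕ) : ℤ))).hom x) =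
        i (k + 1) (p k (g.1 x)) := by
    intro k g
    obtain ⟨g', hg'⟩ := (hD (k + 1)).exists_extend (i := n - (k : ℤ)) (j := n - 1 - (k : ℤ))
      (k := n - 1 - ((k + 1 : ℕ) : ℤ)) (by ring) (by push_cast; ring) (i (k + 1) ∘ₗ p k ∘ₗ g.1)
      fun x => (congrArg (i (k + 1)) (g.2 x)).trans (map_zero _)
    have hg'' : ∀ m (h : m = n - 1 - (k : ℤ)) x,
        p (k + 1) (g' ((C.d m (n - 1 - ((k + 1 : ℕ) : ℤ))).hom x)) = 0 := by
      rintro _ rfl x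
      rw [hg']
      exact (hex (k + 1)).apply_apply_eq_zero _
    exact ⟨⟨g', hg'' _ (by push_cast; ring)⟩, hg'⟩
  obtain ⟨g₀, hg₀⟩ := hG0
  choose next hnext using hG
  let g : ∀ k, G k := fun k => Nat.rec g₀ next k
  obtain ⟨s, hs⟩ := (isPureExact_splice hi hpure hp hex).exists_homotopy
    (E := fun k : ℕ => C.X (n - 1 - (k : ℤ))) (fun k => hC _)
    (fun k => (C.d (n - 1 - (k : ℤ)) (n - 1 - ((k + 1 : ℕ) : ℤ))).hom)
    (fun k x => d_d_apply C _ _ _ x) (fun k => (g k).1)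
    (fun k x => (hnext k (g k) x).symm)
  have hs0 : ∀ x, s 0 ((C.d n (n - 1 - ((0 : ℕ) : ℤ))).hom x) = y x := fun x => by
    apply hi 0
    rw [← hg₀]
    have h1 := hs 0 ((C.d n (n - 1 - ((0 : ℕ) : ℤ))).hom x)
    rw [d_d_apply, map_zero, add_zero] at h1
    exact h1.symm
  have hcast : ∀ m (_ : n - 1 = m) (t : C.X m →ₗ[R] F 0),
      (∀ x, t ((C.d n m).hom x) = y x) →
        ∃ z : C.X (n - 1) →ₗ[R] F 0, ∀ x, z ((C.d n (n - 1)).hom x) = y x := by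
    rintro _ rfl t ht
    exact ⟨t, ht⟩
  exact hcast _ (by simp) (s 0) hs0

/-- The iterated cosyzygies of `F` with respect to the embeddings into double character modules. -/
noncomputable def charCosyzygy (F : ModuleCat.{u} R) : ℕ → ModuleCat.{u} R
  | 0 => F
  | k + 1 => ModuleCat.of R
      (Char (Char (charCosyzygy F k)) ⧸ LinearMap.range (Char.eval (R := R) (charCosyzygy F k)))

theorem IsLevel.charCosyzygy {F : ModuleCat.{u} R} (hF : IsLevel F) (k : ℕ) :
    IsLevel (charCosyzygy F k) := by
  induction k with
  | zero => exact hF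
  | succ k ih => exact ih.char_char_quotient

theorem IsACAcyclic.isFirmlyAcyclic (hC : ∀ n, Module.Projective R (C.X n))
    (h : IsACAcyclic C) : IsFirmlyAcyclic C := fun F hF =>
  homExact_of_pure_coresolution hC (F := charCosyzygy F)
    (D := fun k => ModuleCat.of R (Char (Char (charCosyzygy F k))))
    (i := fun k => Char.eval (charCosyzygy F k)) (p := fun _ => Submodule.mkQ _)
    (fun _ => Char.eval_injective _) (fun _ => Char.isPure_eval _)
    (fun _ => Submodule.mkQ_surjective _) (fun _ => LinearMap.exact_map_mkQ_range _)
    fun k => (tensorExact_iff_homExact_char (ModuleCat.of Rᵐᵒᵖ (Char (charCosyzygy F k)))).1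
      (h _ ((isLevel_iff_char _).1 (hF.charCosyzygy k)))

/-- `Hom_R(C, -)` preserves short exact sequences if `C` consists of projective modules, so
exactness passes to quotients. -/
theorem HomExact.of_shortExact (hC : ∀ n, Module.Projective R (C.X n)) {K P F : ModuleCat.{u} R}
    (f : K →ₗ[R] P) (g : P →ₗ[R] F) (hf : Function.Injective f) (hg : Function.Surjective g)
    (hfg : Function.Exact f g) (hK : HomExact C K) (hP : HomExact C P) : HomExact C F := by
  rw [homExact_iff]
  intro n y hy
  obtain ⟨t, ht⟩ := Module.projective_lifting_property g y hg
  have ht' : ∀ x, g (t x) = y x := LinearMap.congr_fun ht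
  let e := LinearEquiv.ofInjective f hf
  have hr : ∀ x, (t ∘ₗ (C.d (n + 1) n).hom) x ∈ LinearMap.range f := fun x =>
    (hfg _).1 ((ht' _).trans (hy x))
  let v : C.X (n + 1) →ₗ[R] K := e.symm.toLinearMap ∘ₗ LinearMap.codRestrict _ _ hr
  have hv : ∀ x, f (v x) = t ((C.d (n + 1) n).hom x) := fun x =>
    congrArg Subtype.val (e.apply_symm_apply ⟨_, hr x⟩)
  obtain ⟨w, hw⟩ := hK.exists_extend (i := n + 1 + 1) (j := n + 1) (k := n) rfl (by ring) v
    fun x => hf (by rw [hv, d_d_apply, map_zero, map_zero])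
  obtain ⟨z, hz⟩ := hP.exists_extend (i := n + 1) (k := n - 1) rfl rfl (t - f ∘ₗ w)
    fun x => by rw [LinearMap.sub_apply, LinearMap.comp_apply, hw, hv, sub_self]
  refine ⟨g ∘ₗ z, fun x => ?_⟩
  rw [LinearMap.comp_apply, hz, LinearMap.sub_apply, map_sub, ht', LinearMap.comp_apply,
    hfg.apply_apply_eq_zero, sub_zero]

theorem homExact_of_hasProjectiveDimensionLE (hC : ∀ n, Module.Projective R (C.X n))
    (h : ∀ P : ModuleCat.{u} R, Module.Projective R P → HomExact C P) (n : ℕ) :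
    ∀ F : ModuleCat.{u} R, HasProjectiveDimensionLE F n → HomExact C F := by
  induction n with
  | zero =>
    intro F hF
    exact h F ((IsProjective.iff_projective _).2
      ((projective_iff_hasProjectiveDimensionLE_zero F).2 hF))
  | succ n ih =>
    intro F hF
    let g : (F →₀ R) →ₗ[R] F := Finsupp.linearCombination R id
    have hg : Function.Surjective g := Finsupp.linearCombination_id_surjective R F
    let S : ShortComplex (ModuleCat.{u} R) := ShortComplex.mk
      (X₁ := ModuleCat.of R (LinearMap.ker g)) (X₂ := ModuleCat.of R (F →₀ R)) (X₃ := F)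
      (ModuleCat.ofHom (LinearMap.ker g).subtype) (ModuleCat.ofHom g)
      (ModuleCat.hom_ext (LinearMap.ext fun x : LinearMap.ker g => x.2))
    have hex : Function.Exact (LinearMap.ker g).subtype g := LinearMap.exact_subtype_ker_map g
    have hS : S.ShortExact :=
      { exact := (ShortComplex.ShortExact.moduleCat_exact_iff_function_exact S).2 hex
        mono_f := (ModuleCat.mono_iff_injective _).2 (Submodule.subtype_injective _)
        epi_g := (ModuleCat.epi_iff_surjective _).2 hg }
    have hfree : Module.Projective R S.X₂ := inferInstanceAs (Module.Projective R (F →₀ R))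
    have hK : HasProjectiveDimensionLE S.X₁ n := (hS.hasProjectiveDimensionLT_X₃_iff n
      ((IsProjective.iff_projective _).1 hfree)).1 hF
    exact HomExact.of_shortExact hC (K := S.X₁) (P := S.X₂) (LinearMap.ker g).subtype g
      (Submodule.subtype_injective _) hg hex (ih _ hK) (h _ hfree)

end Complexes

end ACModules

theorem theorem6p7 (R : Type u) [Ring R] (C : ChainComplex (ModuleCat.{u} R) ℤ)
    (hC : ∀ n : ℤ, Module.Projective R (C.X n)) :
    (ACModules.IsACAcyclic C ↔ ACModules.IsFirmlyAcyclic C) ∧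
    ((∀ F : ModuleCat.{u} R, ACModules.IsLevel F → ∃ n : ℕ, HasProjectiveDimensionLE F n) →
      ((ACModules.IsACAcyclic C ↔
          ∀ P : ModuleCat.{u} R, Module.Projective R P → ACModules.HomExact C P) ∧
        (ACModules.IsFirmlyAcyclic C ↔
          ∀ P : ModuleCat.{u} R, Module.Projective R P → ACModules.HomExact C P))) := by
  have h12 : ACModules.IsACAcyclic C ↔ ACModules.IsFirmlyAcyclic C :=
    ⟨fun h => h.isFirmlyAcyclic hC, fun h => h.isACAcyclic⟩
  refine ⟨h12, fun hpd => ?_⟩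
  have h23 : ACModules.IsFirmlyAcyclic C ↔
      ∀ P : ModuleCat.{u} R, Module.Projective R P → ACModules.HomExact C P := by
    refine ⟨fun h P _ => h P (ACModules.isLevel_of_projective P), fun h F hF => ?_⟩
    obtain ⟨n, hn⟩ := hpd F hF
    exact ACModules.homExact_of_hasProjectiveDimensionLE hC h n F hn
  exact ⟨h12.trans h23, h23⟩
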